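/- All Hilbert spaces are finite-dimensional and nonzero, and $d_X$ is the dimension of $\mathcal H_X$. A \emph{process matrix} on $AB=A_IA_OB_IB_O$ is a matrix $W\ge 0$ on $\mathcal H_{A_I}\otimes\mathcal H_{A_O}\otimes\mathcal H_{B_I}\otimes\mathcal H_{B_O}$ with $\operatorname{tr}[W^{\mathrm T}(M_A\otimes M_B)]=1$ for all Choi matrices $M_X$ of CPTP maps from $X_I$ to $X_O$ (that is, $M_X\ge 0$ and $\operatorname{tr}_{X_O}M_X=\mathbb 1_{X_I}$), $X\in\{A,B\}$; the set of them is $\mathrm{Proc}_{AB}$. Write ${}_XM=\frac{\mathbb 1_X}{d_X}\otimes\operatorname{tr}_XM$. A \emph{free (non-signalling) adapter} $AB\to A'B'$ is a matrix $\Upsilon\ge 0$ on the tensor product of the eight spaces of $AB$ and $A'B'$ such that $\Upsilon=(L_A\otimes L_B)[\Upsilon]$ and $\operatorname{tr}\Upsilon=d_{A_I}d_{A_O'}d_{B_I}d_{B_O'}$, where $$L_X[\Upsilon]=\Upsilon-{}_{X_O}\Upsilon+{}_{X_OX_O'}\Upsilon-{}_{X_I'X_OX_O'}\Upsilon+{}_{X_IX_I'X_OX_O'}\Upsilon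 .$$ It acts on $W$ by $\Upsilon(W)=\operatorname{tr}_{AB}[\Upsilon(\mathbb 1_{A'B'}\otimes W^{\mathrm T})]$. For a process matrix $Q$ on $A'B'$ and a process matrix $W$ on any bipartite system $AB$ put $$f_Q(W)=\max_{\Upsilon}\operatorname{tr}\bigl(Q\,\Upsilon(W)\bigr),$$ the maximum being over all free adapters $\Upsilon:AB\to A'B'$. \textbf{Proposition.} The maximum defining $f_Q(W)$ is attained, and each $f_Q$ is a monotone: $f_Q(\Gamma(W))\le f_Q(W)$ for every free adapter $\Gamma$ from $AB$ to any bipartite system. Moreover, for all $W\in\mathrm{Proc}_{AB}$ and $W'\in\mathrm{Proc}_{A'B'}$, there is a free adapter $\Upsilon:AB\to A'B'$ with $W'=\Upsilon(W)$ if and only if $$f_Q(W)\ \ge\ f_Q(W')\qquad\text{for all } Q\in\mathrm{Proc}_{A'B'}.$$ Thus the functions $f_Q$ form a complete set of monotones. -/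

import Mathlib

open Matrix
open scoped Kronecker ComplexOrder

namespace CausalConnection

/-- The operator on the composite system `x ⊗ y`, tensor factors indexed by `x` and `y`, obtained by
tracing out the first factor. -/
def trFst {x y : Type*} [Fintype x] (M : Matrix (x × y) (x × y) ℂ) : Matrix y y ℂ :=
  Matrix.of fun i j => ∑ k, M (k, i) (k, j)

/-- Tracing out the second tensor factor. -/
def trSnd {x y : Type*} [Fintype y] (M : Matrix (x × y) (x × y) ℂ) : Matrix x x ℂ :=
  Matrix.of fun i j => ∑ k, M (i, k) (j, k)

/-- The trace-and-replace map `M ↦ (𝟙_X / d_X) ⊗ tr_X M`, written `_X M` in the physics literature,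
where the equivalence `e` exhibits the full system `n` as the subsystem `x` times the rest `y`. -/
noncomputable def replaceTr {n x y : Type*} [Fintype x] [DecidableEq x] (e : n ≃ x × y)
    (M : Matrix n n ℂ) : Matrix n n ℂ :=
  Matrix.reindex e.symm e.symm
    (((Fintype.card x : ℂ)⁻¹ • (1 : Matrix x x ℂ)) ⊗ₖ trFst (Matrix.reindex e e M))

/-- `M` on `X_I ⊗ X_O` is the Choi matrix of a completely positive trace-preserving map from
`X_I` to `X_O`: it is positive semidefinite and `tr_{X_O} M = 𝟙_{X_I}`. -/
def IsChannel {I O : Type*} [DecidableEq I] [Fintype O]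
    (M : Matrix (I × O) (I × O) ℂ) : Prop :=
  M.PosSemidef ∧ trSnd M = 1

/-- `W` on `(A_I ⊗ A_O) ⊗ (B_I ⊗ B_O)` is a proper process matrix: `W ≥ 0` and
`tr[Wᵀ (M_A ⊗ M_B)] = 1` for all Choi matrices `M_A`, `M_B` of CPTP maps. -/
def IsProcess {AI AO BI BO : Type*} [Fintype AI] [Fintype AO] [Fintype BI] [Fintype BO]
    [DecidableEq AI] [DecidableEq BI]
    (W : Matrix ((AI × AO) × (BI × BO)) ((AI × AO) × (BI × BO)) ℂ) : Prop :=
  W.PosSemidef ∧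
    ∀ (MA : Matrix (AI × AO) (AI × AO) ℂ) (MB : Matrix (BI × BO) (BI × BO) ℂ),
      IsChannel MA → IsChannel MB → (Wᵀ * (MA ⊗ₖ MB)).trace = 1

/-- The four wires of one party in an adapter, in the order `X_I ≺ X_I' ≺ X_O' ≺ X_O`. -/
abbrev Wires (I I' O' O : Type*) := I × I' × O' × O

section LocalProjector

variable {I I' O' O R : Type*}

/-- Singles out `X_O`; `R` is a spectator system. -/
def splitO : Wires I I' O' O × R ≃ O × ((I × I' × O') × R) where
  toFun p := (p.1.2.2.2, ((p.1.1, p.1.2.1, p.1.2.2.1), p.2))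
  invFun q := ((q.2.1.1, q.2.1.2.1, q.2.1.2.2, q.1), q.2.2)
  left_inv _ := rfl
  right_inv _ := rfl

/-- Singles out `X_O' X_O`. -/
def splitOO : Wires I I' O' O × R ≃ (O' × O) × ((I × I') × R) where
  toFun p := (p.1.2.2, ((p.1.1, p.1.2.1), p.2))
  invFun q := ((q.2.1.1, q.2.1.2, q.1), q.2.2)
  left_inv _ := rfl
  right_inv _ := rfl

/-- Singles out `X_I' X_O' X_O`. -/
def splitIOO : Wires I I' O' O × R ≃ (I' × O' × O) × (I × R) where
  toFun p := (p.1.2, (p.1.1, p.2))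
  invFun q := ((q.2.1, q.1), q.2.2)
  left_inv _ := rfl
  right_inv _ := rfl

variable [Fintype I] [Fintype I'] [Fintype O'] [Fintype O]
  [DecidableEq I] [DecidableEq I'] [DecidableEq O'] [DecidableEq O]

/-- The projector `L_X[Υ] = Υ - _{X_O}Υ + _{X_O X_O'}Υ - _{X_I' X_O X_O'}Υ + _{X_I X_I' X_O X_O'}Υ`
for the party holding the first tensor factor, acting as the identity on the spectator `R`. -/
noncomputable def localProj (Y : Matrix (Wires I I' O' O × R) (Wires I I' O' O × R) ℂ) :
    Matrix (Wires I I' O' O × R) (Wires I I' O' O × R) ℂ :=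
  Y - replaceTr splitO Y + replaceTr splitOO Y - replaceTr splitIOO Y
    + replaceTr (Equiv.refl (Wires I I' O' O × R)) Y

end LocalProjector

section Adapter

variable {AI AO BI BO AI' AO' BI' BO' : Type*}

/-- The matrices in which Choi matrices of adapters from processes on `A_I A_O B_I B_O` to
processes on `A_I' A_O' B_I' B_O'` live. -/
abbrev AdapterMatrix (AI AO BI BO AI' AO' BI' BO' : Type*) :=
  Matrix (Wires AI AI' AO' AO × Wires BI BI' BO' BO) (Wires AI AI' AO' AO × Wires BI BI' BO' BO) ℂ

/-- Regroups the wires of an adapter as (wires of the new process, wires of the old process). -/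
def regroup : Wires AI AI' AO' AO × Wires BI BI' BO' BO ≃
    ((AI' × AO') × (BI' × BO')) × ((AI × AO) × (BI × BO)) where
  toFun p := (((p.1.2.1, p.1.2.2.1), (p.2.2.1, p.2.2.2.1)),
    ((p.1.1, p.1.2.2.2), (p.2.1, p.2.2.2.2)))
  invFun q := ((q.2.1.1, q.1.1.1, q.1.1.2, q.2.1.2), (q.2.2.1, q.1.2.1, q.1.2.2, q.2.2.2))
  left_inv _ := rfl
  right_inv _ := rfl

variable [Fintype AI] [Fintype AO] [Fintype BI] [Fintype BO]
  [Fintype AI'] [Fintype AO'] [Fintype BI'] [Fintype BO']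

/-- The action of an adapter on `W`, i.e. the link product `Υ ⋆ W = tr_{AB}[Υ (𝟙_{A'B'} ⊗ Wᵀ)]`. -/
noncomputable def adapt [DecidableEq AI'] [DecidableEq AO'] [DecidableEq BI'] [DecidableEq BO']
    (Y : AdapterMatrix AI AO BI BO AI' AO' BI' BO')
    (W : Matrix ((AI × AO) × (BI × BO)) ((AI × AO) × (BI × BO)) ℂ) :
    Matrix ((AI' × AO') × (BI' × BO')) ((AI' × AO') × (BI' × BO')) ℂ :=
  trSnd (Matrix.reindex regroup regroup Y *
    ((1 : Matrix ((AI' × AO') × (BI' × BO')) ((AI' × AO') × (BI' × BO')) ℂ) ⊗ₖ Wᵀ))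

variable [DecidableEq AI] [DecidableEq AO] [DecidableEq BI] [DecidableEq BO]
  [DecidableEq AI'] [DecidableEq AO'] [DecidableEq BI'] [DecidableEq BO']

/-- `L_A`, acting on Alice's wires only. -/
noncomputable def projA (Y : AdapterMatrix AI AO BI BO AI' AO' BI' BO') :
    AdapterMatrix AI AO BI BO AI' AO' BI' BO' :=
  localProj Y

/-- `L_B`, acting on Bob's wires only. -/
noncomputable def projB (Y : AdapterMatrix AI AO BI BO AI' AO' BI' BO') :
    AdapterMatrix AI AO BI BO AI' AO' BI' BO' :=
  Matrix.reindex (Equiv.prodComm _ _) (Equiv.prodComm _ _)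
    (localProj (Matrix.reindex (Equiv.prodComm _ _) (Equiv.prodComm _ _) Y))

/-- Choi matrices of the free (non-signalling) adapters: `Υ ≥ 0`, `Υ = (L_A ⊗ L_B)[Υ]`, and the
trace is the dimension of the inputs `A_I, A_O', B_I, B_O'` of the adapter. -/
def IsFreeAdapter (Y : AdapterMatrix AI AO BI BO AI' AO' BI' BO') : Prop :=
  Y.PosSemidef ∧ Y = projA (projB Y) ∧
    Y.trace = (Fintype.card AI : ℂ) * Fintype.card AO' * Fintype.card BI * Fintype.card BO'

/-- The values `tr(Q Υ(W))`, with `Υ` running over the free adapters from the spaces of `W` to the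
spaces of `Q`. They are real, because `Q` and `Υ(W)` are Hermitian for processes `Q` and `W`. -/
def freeValues (Q : Matrix ((AI' × AO') × (BI' × BO')) ((AI' × AO') × (BI' × BO')) ℂ)
    (W : Matrix ((AI × AO) × (BI × BO)) ((AI × AO) × (BI × BO)) ℂ) : Set ℝ :=
  {r | ∃ Y : AdapterMatrix AI AO BI BO AI' AO' BI' BO',
    IsFreeAdapter Y ∧ r = (Q * adapt Y W).trace.re}

/-- `f_Q(W) = max_Υ tr(Q Υ(W))`. -/
noncomputable def monotone
    (Q : Matrix ((AI' × AO') × (BI' × BO')) ((AI' × AO') × (BI' × BO')) ℂ)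
    (W : Matrix ((AI × AO) × (BI × BO)) ((AI × AO) × (BI × BO)) ℂ) : ℝ :=
  sSup (freeValues Q W)

end Adapter

end CausalConnection

set_option linter.unusedSectionVars false

/-! The free adapters form a compact convex set, so the maxima are attained and the processes
reachable from `W` form a compact convex set `K`. If `W'` is not in `K`, let `X₀` be the point of
`K` nearest to `W'` in Hilbert–Schmidt distance; then `D = W' - X₀` separates `W'` from `K`
(`exists_separating`). The witness must be a process, and `D` is not one. But `D` is a difference of
processes, so `Q = c (1 + ε D)` is a process for suitable `c, ε > 0`, and since all processes on the
same spaces have the same trace, `Q` orders them as `D` does. The identity adapter is free, hence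
`f_Q(W') ≥ tr(Q W') > f_Q(W)`.

Monotonicity and the fact that `K` consists of processes both rest on closure of free adapters under
composition. This is visible once `Υ = (L_A ⊗ L_B)[Υ]` is replaced by linear conditions on blocks:
every block on Alice's wires, and every block on Bob's, lies in the span of one-party combs
(`isFreeAdapter_iff`). That span is stable under the link product (`localComp_mem`). Testing `Υ(W)`
on a pair of channels then amounts to pairing `W` with a free adapter with trivial output, and this
gives 1 by bilinear extension from pairs of channels (`IsProcess.adapt_closing_eq_one`). -/

namespace CausalConnection

/-! ### One-party combs and the range of the projector `L_X` -/

section Comb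

variable {I I' O' O R : Type*} [Fintype I] [Fintype I'] [Fintype O'] [Fintype O]
  [DecidableEq I] [DecidableEq I'] [DecidableEq O'] [DecidableEq O]

theorem replaceTr_apply {n x y : Type*} [Fintype x] [DecidableEq x] (e : n ≃ x × y)
    (M : Matrix n n ℂ) (p q : n) :
    replaceTr e M p q = if (e p).1 = (e q).1 then
      (Fintype.card x : ℂ)⁻¹ * ∑ k, M (e.symm (k, (e p).2)) (e.symm (k, (e q).2)) else 0 := by
  simp [replaceTr, trFst, Matrix.one_apply]

/-- The block of `Y` on the first tensor factor at fixed indices of the second factor. -/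
def sliceFst {x y : Type*} (Y : Matrix (x × y) (x × y) ℂ) (b b' : y) : Matrix x x ℂ :=
  Matrix.of fun a a' => Y (a, b) (a', b')

/-- The block of `Y` on the second tensor factor at fixed indices of the first factor. -/
def sliceSnd {x y : Type*} (Y : Matrix (x × y) (x × y) ℂ) (a a' : x) : Matrix y y ℂ :=
  Matrix.of fun b b' => Y (a, b) (a', b')

/-- The linear span of the two-slot combs on the wires `I ≺ I' ≺ O' ≺ O`. -/
def combSpace (I I' O' O : Type*) [Fintype I'] [Fintype O] [DecidableEq I] [DecidableEq O'] :
    Submodule ℂ (Matrix (Wires I I' O' O) (Wires I I' O' O) ℂ) where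
  carrier := {M | ∃ (N : I → I' → I → I' → ℂ) (c : ℂ),
    (∀ i i' o' j j' p', ∑ o, M (i, i', o', o) (j, j', p', o) =
      if o' = p' then N i i' j j' else 0) ∧
    ∀ i j, ∑ i', N i i' j i' = if i = j then c else 0}
  add_mem' := by
    rintro M M' ⟨N, c, h1, h2⟩ ⟨N', c', h1', h2'⟩
    refine ⟨N + N', c + c', fun i i' o' j j' p' => ?_, fun i j => ?_⟩
    · simp only [Matrix.add_apply, Finset.sum_add_distrib, h1, h1', Pi.add_apply]
      split_ifs <;> simp
    · simp only [Pi.add_apply, Finset.sum_add_distrib, h2, h2']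
      split_ifs <;> simp
  zero_mem' := ⟨0, 0, by simp, by simp⟩
  smul_mem' := by
    rintro a M ⟨N, c, h1, h2⟩
    refine ⟨a • N, a * c, fun i i' o' j j' p' => ?_, fun i j => ?_⟩
    · simp only [Matrix.smul_apply, smul_eq_mul, ← Finset.mul_sum, h1, Pi.smul_apply]
      split_ifs <;> simp
    · simp only [Pi.smul_apply, smul_eq_mul, ← Finset.mul_sum, h2]
      split_ifs <;> simp

theorem trace_wires (M : Matrix (Wires I I' O' O) (Wires I I' O' O) ℂ) :
    M.trace = ∑ i, ∑ o', ∑ i', ∑ o, M (i, i', o', o) (i, i', o', o) := by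
  simp only [Matrix.trace, Matrix.diag, Fintype.sum_prod_type]
  exact Finset.sum_congr rfl fun i _ => Finset.sum_comm

theorem trace_eq_of_comb {M : Matrix (Wires I I' O' O) (Wires I I' O' O) ℂ}
    {N : I → I' → I → I' → ℂ} {c : ℂ}
    (h1 : ∀ i i' o' j j' p', ∑ o, M (i, i', o', o) (j, j', p', o) =
      if o' = p' then N i i' j j' else 0)
    (h2 : ∀ i j, ∑ i', N i i' j i' = if i = j then c else 0) :
    M.trace = Fintype.card I * Fintype.card O' * c := by
  rw [trace_wires]
  simp [h1, h2, mul_assoc]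

theorem localProj_apply (Y : Matrix (Wires I I' O' O × R) (Wires I I' O' O × R) ℂ)
    (i i' o' o r j j' p' p s) :
    localProj Y ((i, i', o', o), r) ((j, j', p', p), s) =
      Y ((i, i', o', o), r) ((j, j', p', p), s)
      - (if o = p then (Fintype.card O : ℂ)⁻¹ *
          ∑ x, Y ((i, i', o', x), r) ((j, j', p', x), s) else 0)
      + (if o' = p' ∧ o = p then ((Fintype.card O' : ℂ) * Fintype.card O)⁻¹ *
          ∑ x', ∑ x, Y ((i, i', x', x), r) ((j, j', x', x), s) else 0)
      - (if i' = j' ∧ o' = p' ∧ o = p then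
          ((Fintype.card I' : ℂ) * (Fintype.card O' * Fintype.card O))⁻¹ *
          ∑ y', ∑ x', ∑ x, Y ((i, y', x', x), r) ((j, y', x', x), s) else 0)
      + (if i = j ∧ i' = j' ∧ o' = p' ∧ o = p then
          ((Fintype.card I : ℂ) * (Fintype.card I' * (Fintype.card O' * Fintype.card O)))⁻¹ *
          ∑ y, ∑ y', ∑ x', ∑ x, Y ((y, y', x', x), r) ((y, y', x', x), s) else 0) := by
  simp only [localProj, Matrix.add_apply, Matrix.sub_apply, replaceTr_apply, splitO, splitOO,
    splitIOO, Equiv.refl_apply, Equiv.refl_symm, Equiv.coe_fn_mk, Equiv.coe_fn_symm_mk,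
    Fintype.card_prod, Nat.cast_mul, Fintype.sum_prod_type, Prod.mk.injEq]

/-- The sum defining `L_X` telescopes: tracing out `O` cancels its first two terms, and then tracing
out `I'` cancels the next two. -/
theorem sliceFst_localProj_mem [Nonempty I'] [Nonempty O'] [Nonempty O]
    (Y : Matrix (Wires I I' O' O × R) (Wires I I' O' O × R) ℂ) (r s : R) :
    sliceFst (localProj Y) r s ∈ combSpace I I' O' O := by
  have hO : (Fintype.card O : ℂ) ≠ 0 := by simp
  have hO' : (Fintype.card O' : ℂ) ≠ 0 := by simp
  have hI' : (Fintype.card I' : ℂ) ≠ 0 := by simp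
  -- These are what remains of the last three terms after removing `O` and the factor `𝟙_{O'}`, and
  -- of the last term after removing `I'` and `𝟙_I` as well.
  refine ⟨fun i i' j j' => (Fintype.card O' : ℂ)⁻¹ *
        (∑ x', ∑ x, Y ((i, i', x', x), r) ((j, j', x', x), s))
      - (if i' = j' then ((Fintype.card I' : ℂ) * Fintype.card O')⁻¹ *
          ∑ y', ∑ x', ∑ x, Y ((i, y', x', x), r) ((j, y', x', x), s) else 0)
      + (if i = j ∧ i' = j' then ((Fintype.card I : ℂ) * (Fintype.card I' * Fintype.card O'))⁻¹ *
          ∑ y, ∑ y', ∑ x', ∑ x, Y ((y, y', x', x), r) ((y, y', x', x), s) else 0),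
    ((Fintype.card I : ℂ) * Fintype.card O')⁻¹ *
          ∑ y, ∑ y', ∑ x', ∑ x, Y ((y, y', x', x), r) ((y, y', x', x), s), ?_, ?_⟩
  · intro i i' o' j j' p'
    simp only [sliceFst, Matrix.of_apply, localProj_apply, Finset.sum_add_distrib,
      Finset.sum_sub_distrib, and_true, if_true]
    by_cases h1 : o' = p' <;> by_cases h2 : i' = j' <;> by_cases h3 : i = j <;>
      simp [h1, h2, h3] <;> field_simp
  · intro i j
    simp only [Finset.sum_add_distrib, Finset.sum_sub_distrib, ← Finset.mul_sum]
    by_cases h3 : i = j <;> simp [h3] <;> field_simp <;> ring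

/-- On a comb, replacing `O` already replaces `O'`, and replacing `I' O' O` already replaces `I`, so
the four correction terms cancel in pairs. -/
theorem localProj_eq_self [Nonempty I] [Nonempty I'] [Nonempty O'] [Nonempty O]
    (Y : Matrix (Wires I I' O' O × R) (Wires I I' O' O × R) ℂ)
    (h : ∀ r s, sliceFst Y r s ∈ combSpace I I' O' O) : localProj Y = Y := by
  have hO : (Fintype.card O : ℂ) ≠ 0 := by simp
  have hO' : (Fintype.card O' : ℂ) ≠ 0 := by simp
  have hI' : (Fintype.card I' : ℂ) ≠ 0 := by simp
  have hI : (Fintype.card I : ℂ) ≠ 0 := by simp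
  ext ⟨⟨i, i', o', o⟩, r⟩ ⟨⟨j, j', p', p⟩, s⟩
  obtain ⟨N, c, h1, h2⟩ := h r s
  simp only [sliceFst, Matrix.of_apply] at h1
  have h3 : ∀ i j, ∑ y', ∑ x', ∑ x, Y ((i, y', x', x), r) ((j, y', x', x), s) =
      Fintype.card O' * if i = j then c else 0 := by
    intro i j
    simp only [h1, if_true, Finset.sum_const, Finset.card_univ, nsmul_eq_mul, ← Finset.mul_sum, h2]
  rw [localProj_apply]
  simp only [h3]
  simp only [h1]
  by_cases h4 : o = p <;> by_cases h5 : o' = p' <;> by_cases h6 : i' = j' <;>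
    by_cases h7 : i = j <;> simp [h4, h5, h6, h7] <;> field_simp <;> ring

/-- `L_X` mixes only the indices of its own party, so the other party's blocks are merely combined
linearly. -/
theorem sliceSnd_localProj_mem (Y : Matrix (Wires I I' O' O × R) (Wires I I' O' O × R) ℂ)
    (S : Submodule ℂ (Matrix R R ℂ)) (h : ∀ a a', sliceSnd Y a a' ∈ S)
    (a a' : Wires I I' O' O) : sliceSnd (localProj Y) a a' ∈ S := by
  obtain ⟨i, i', o', o⟩ := a
  obtain ⟨j, j', p', p⟩ := a'
  have key : sliceSnd (localProj Y) (i, i', o', o) (j, j', p', p) =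
      sliceSnd Y (i, i', o', o) (j, j', p', p)
      - (if o = p then (Fintype.card O : ℂ)⁻¹ else 0) •
          (∑ x, sliceSnd Y (i, i', o', x) (j, j', p', x))
      + (if o' = p' ∧ o = p then ((Fintype.card O' : ℂ) * Fintype.card O)⁻¹ else 0) •
          (∑ x', ∑ x, sliceSnd Y (i, i', x', x) (j, j', x', x))
      - (if i' = j' ∧ o' = p' ∧ o = p then
          ((Fintype.card I' : ℂ) * (Fintype.card O' * Fintype.card O))⁻¹ else 0) •
          (∑ y', ∑ x', ∑ x, sliceSnd Y (i, y', x', x) (j, y', x', x))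
      + (if i = j ∧ i' = j' ∧ o' = p' ∧ o = p then
          ((Fintype.card I : ℂ) * (Fintype.card I' * (Fintype.card O' * Fintype.card O)))⁻¹
            else 0) •
          ∑ y, ∑ y', ∑ x', ∑ x, sliceSnd Y (y, y', x', x) (y, y', x', x) := by
    ext r s
    simp only [sliceSnd, Matrix.of_apply, localProj_apply, Matrix.add_apply, Matrix.sub_apply,
      Matrix.smul_apply, Matrix.sum_apply, smul_eq_mul, ite_mul, zero_mul]
  rw [key]
  refine S.add_mem (S.sub_mem (S.add_mem (S.sub_mem (h _ _) ?_) ?_) ?_) ?_ <;>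
    refine S.smul_mem _ ?_ <;> repeat' refine S.sum_mem fun _ _ => ?_
  all_goals exact h _ _

end Comb

/-! ### Composition of one-party combs -/

section Composition

variable {I O CI CO EI EO : Type*} [Fintype I] [Fintype O] [Fintype CI] [Fintype CO]
  [Fintype EI] [Fintype EO] [DecidableEq I] [DecidableEq O] [DecidableEq CI] [DecidableEq CO]
  [DecidableEq EI] [DecidableEq EO]

/-- The link product of two combs of a single party along the wires `CI`, `CO`. -/
def localComp (M : Matrix (Wires CI EI EO CO) (Wires CI EI EO CO) ℂ)
    (N : Matrix (Wires I CI CO O) (Wires I CI CO O) ℂ) :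
    Matrix (Wires I EI EO O) (Wires I EI EO O) ℂ :=
  Matrix.of fun p q => ∑ c : CI × CO, ∑ d : CI × CO,
    M (c.1, p.2.1, p.2.2.1, c.2) (d.1, q.2.1, q.2.2.1, d.2) *
      N (p.1, c.1, c.2, p.2.2.2) (q.1, d.1, d.2, q.2.2.2)

/-- The wires are removed against the causal order: tracing `O` out of `N` forces equal indices on
`CO`, which traces `CO` out of `M`; tracing `EI` out of `M₁` does the same on `CI`, which is then
traced out of `N₁`. -/
theorem localComp_aux {M : Matrix (Wires CI EI EO CO) (Wires CI EI EO CO) ℂ}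
    {N : Matrix (Wires I CI CO O) (Wires I CI CO O) ℂ}
    {M₁ : CI → EI → CI → EI → ℂ} {m : ℂ}
    (hM : ∀ i i' o' j j' p', ∑ o, M (i, i', o', o) (j, j', p', o) =
      if o' = p' then M₁ i i' j j' else 0)
    (hm : ∀ i j, ∑ i', M₁ i i' j i' = if i = j then m else 0)
    {N₁ : I → CI → I → CI → ℂ} {n : ℂ}
    (hN : ∀ i i' o' j j' p', ∑ o, N (i, i', o', o) (j, j', p', o) =
      if o' = p' then N₁ i i' j j' else 0)
    (hn : ∀ i j, ∑ i', N₁ i i' j i' = if i = j then n else 0) :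
    (∀ i i' o' j j' p', ∑ o, localComp M N (i, i', o', o) (j, j', p', o) =
      if o' = p' then ∑ c, ∑ d, M₁ c i' d j' * N₁ i c j d else 0) ∧
    ∀ i j, ∑ i', ∑ c, ∑ d, M₁ c i' d i' * N₁ i c j d = if i = j then m * n else 0 := by
  constructor
  · intro i i' o' j j' p'
    simp only [localComp, Matrix.of_apply]
    rw [Finset.sum_comm]
    simp_rw [Finset.sum_comm (s := (Finset.univ : Finset O)), ← Finset.mul_sum, hN]
    simp only [Fintype.sum_prod_type, mul_ite, mul_zero, Finset.sum_ite_eq, Finset.mem_univ,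
      if_true]
    simp_rw [Finset.sum_comm (s := (Finset.univ : Finset CO)), ← Finset.sum_mul, hM]
    split_ifs <;> simp
  · intro i j
    rw [Finset.sum_comm]
    simp_rw [Finset.sum_comm (s := (Finset.univ : Finset EI)), ← Finset.sum_mul, hm]
    simp [← Finset.mul_sum, hn]

theorem localComp_mem {M : Matrix (Wires CI EI EO CO) (Wires CI EI EO CO) ℂ}
    {N : Matrix (Wires I CI CO O) (Wires I CI CO O) ℂ}
    (hM : M ∈ combSpace CI EI EO CO) (hN : N ∈ combSpace I CI CO O) :
    localComp M N ∈ combSpace I EI EO O := by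
  obtain ⟨M₁, m, hM, hm⟩ := hM
  obtain ⟨N₁, n, hN, hn⟩ := hN
  exact ⟨_, _, localComp_aux hM hm hN hn⟩

theorem trace_localComp {M : Matrix (Wires CI EI EO CO) (Wires CI EI EO CO) ℂ}
    {N : Matrix (Wires I CI CO O) (Wires I CI CO O) ℂ}
    (hM : M ∈ combSpace CI EI EO CO) (hN : N ∈ combSpace I CI CO O) :
    Fintype.card CI * Fintype.card CO * (localComp M N).trace = M.trace * N.trace := by
  obtain ⟨M₁, m, hM, hm⟩ := hM
  obtain ⟨N₁, n, hN, hn⟩ := hN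
  have h := localComp_aux hM hm hN hn
  rw [trace_eq_of_comb hM hm, trace_eq_of_comb hN hn, trace_eq_of_comb h.1 h.2]
  ring

end Composition

/-! ### Positivity of the link product -/

section Link

variable {P M K : Type*} [Fintype P] [Fintype M] [Fintype K]

/-- The link product of `Z` on `P ⊗ M` and `Y` on `M ⊗ K` along the common system `M`. -/
def link (Z : Matrix (P × M) (P × M) ℂ) (Y : Matrix (M × K) (M × K) ℂ) :
    Matrix (P × K) (P × K) ℂ :=
  Matrix.of fun p q => ∑ m, ∑ n, Z (p.1, m) (q.1, n) * Y (m, p.2) (n, q.2)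

theorem posSemidef_link {Z : Matrix (P × M) (P × M) ℂ} {Y : Matrix (M × K) (M × K) ℂ}
    (hZ : Z.PosSemidef) (hY : Y.PosSemidef) : (link Z Y).PosSemidef := by
  classical
  -- `V` inserts the unnormalised maximally entangled vector on the two copies of `M`; the link
  -- product is the resulting compression of `Z ⊗ Y`.
  let V : Matrix ((P × M) × (M × K)) (P × K) ℂ := Matrix.of fun s t =>
    if s.1.1 = t.1 ∧ s.2.2 = t.2 ∧ s.1.2 = s.2.1 then 1 else 0
  suffices h : link Z Y = Vᴴ * (Z ⊗ₖ Y) * V from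
    h ▸ (hZ.kronecker hY).conjTranspose_mul_mul_same V
  ext ⟨p, k⟩ ⟨q, l⟩
  simp only [link, Matrix.of_apply, Matrix.mul_apply, Matrix.conjTranspose_apply, V,
    Fintype.sum_prod_type, Matrix.kroneckerMap_apply, ite_and, apply_ite star, star_one, star_zero,
    ite_mul, one_mul, zero_mul, mul_ite, mul_one, mul_zero, Finset.sum_ite_eq, Finset.sum_ite_eq',
    Finset.sum_const_zero, Finset.mem_univ, if_true, Finset.sum_ite_irrel]
  rw [Finset.sum_comm]

end Link

/-! ### Bipartite adapters: action, composition, identity -/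

section Adapters

variable {AI AO BI BO CI CO DI DO EI EO FI FO : Type*}
  [Fintype AI] [Fintype AO] [Fintype BI] [Fintype BO]
  [Fintype CI] [Fintype CO] [Fintype DI] [Fintype DO]
  [Fintype EI] [Fintype EO] [Fintype FI] [Fintype FO]
  [DecidableEq AI] [DecidableEq AO] [DecidableEq BI] [DecidableEq BO]
  [DecidableEq CI] [DecidableEq CO] [DecidableEq DI] [DecidableEq DO]
  [DecidableEq EI] [DecidableEq EO] [DecidableEq FI] [DecidableEq FO]

theorem adapt_apply (Y : AdapterMatrix AI AO BI BO CI CO DI DO)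
    (W : Matrix ((AI × AO) × (BI × BO)) ((AI × AO) × (BI × BO)) ℂ)
    (p q : (CI × CO) × (DI × DO)) :
    adapt Y W p q = ∑ k, ∑ l, Y (regroup.symm (p, k)) (regroup.symm (q, l)) * W k l := by
  simp [adapt, trSnd, Matrix.mul_apply, Fintype.sum_prod_type (α₂ := (AI × AO) × BI × BO),
    Matrix.one_apply]

theorem posSemidef_adapt {Y : AdapterMatrix AI AO BI BO CI CO DI DO}
    {W : Matrix ((AI × AO) × (BI × BO)) ((AI × AO) × (BI × BO)) ℂ}
    (hY : Y.PosSemidef) (hW : W.PosSemidef) : (adapt Y W).PosSemidef := by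
  have h := (posSemidef_link (hY.submatrix regroup.symm)
    (hW.submatrix (Prod.fst : _ × Unit → _))).submatrix fun p => (p, ())
  convert h using 1
  ext p q
  simp [adapt_apply, link]

/-- The composition of adapters, i.e. the link product `Z ⋆ Y`. -/
def comp (Z : AdapterMatrix CI CO DI DO EI EO FI FO) (Y : AdapterMatrix AI AO BI BO CI CO DI DO) :
    AdapterMatrix AI AO BI BO EI EO FI FO :=
  (link (Z.submatrix regroup.symm regroup.symm)
    (Y.submatrix regroup.symm regroup.symm)).submatrix regroup regroup

theorem adapt_comp (Z : AdapterMatrix CI CO DI DO EI EO FI FO)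
    (Y : AdapterMatrix AI AO BI BO CI CO DI DO)
    (W : Matrix ((AI × AO) × (BI × BO)) ((AI × AO) × (BI × BO)) ℂ) :
    adapt (comp Z Y) W = adapt Z (adapt Y W) := by
  ext p q
  simp only [adapt_apply, comp, link, Matrix.submatrix_apply, Equiv.apply_symm_apply,
    Matrix.of_apply, Finset.sum_mul, Finset.mul_sum]
  rw [Finset.sum_congr rfl fun k _ => Finset.sum_comm]
  rw [Finset.sum_comm]
  refine Finset.sum_congr rfl fun m _ => ?_
  simp_rw [Finset.sum_comm (s := (Finset.univ : Finset ((AI × AO) × BI × BO)))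
    (t := (Finset.univ : Finset ((CI × CO) × DI × DO)))]
  simp only [mul_assoc]

theorem sliceFst_comp (Z : AdapterMatrix CI CO DI DO EI EO FI FO)
    (Y : AdapterMatrix AI AO BI BO CI CO DI DO) (b b' : Wires BI FI FO BO) :
    sliceFst (comp Z Y) b b' = ∑ d : DI × DO, ∑ d' : DI × DO,
      localComp (sliceFst Z (d.1, b.2.1, b.2.2.1, d.2) (d'.1, b'.2.1, b'.2.2.1, d'.2))
        (sliceFst Y (b.1, d.1, d.2, b.2.2.2) (b'.1, d'.1, d'.2, b'.2.2.2)) := by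
  ext a a'
  simp only [sliceFst, comp, link, localComp, Matrix.submatrix_apply, Matrix.of_apply,
    Matrix.sum_apply]
  rw [Fintype.sum_prod_type, Finset.sum_comm]
  refine Finset.sum_congr rfl fun d _ => ?_
  simp_rw [Fintype.sum_prod_type (α₁ := CI × CO) (α₂ := DI × DO)]
  rw [Finset.sum_congr rfl fun c _ => Finset.sum_comm]
  rw [Finset.sum_comm]
  rfl

theorem sliceSnd_comp (Z : AdapterMatrix CI CO DI DO EI EO FI FO)
    (Y : AdapterMatrix AI AO BI BO CI CO DI DO) (a a' : Wires AI EI EO AO) :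
    sliceSnd (comp Z Y) a a' = ∑ c : CI × CO, ∑ c' : CI × CO,
      localComp (sliceSnd Z (c.1, a.2.1, a.2.2.1, c.2) (c'.1, a'.2.1, a'.2.2.1, c'.2))
        (sliceSnd Y (a.1, c.1, c.2, a.2.2.2) (a'.1, c'.1, c'.2, a'.2.2.2)) := by
  ext b b'
  simp only [sliceSnd, comp, link, localComp, Matrix.submatrix_apply, Matrix.of_apply,
    Matrix.sum_apply]
  rw [Fintype.sum_prod_type]
  refine Finset.sum_congr rfl fun c _ => ?_
  simp_rw [Fintype.sum_prod_type (α₁ := CI × CO) (α₂ := DI × DO)]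
  rw [Finset.sum_comm]
  rfl

theorem trace_eq_sum_sliceFst {x y : Type*} [Fintype x] [Fintype y]
    (Y : Matrix (x × y) (x × y) ℂ) : Y.trace = ∑ b, (sliceFst Y b b).trace := by
  simp only [Matrix.trace, Matrix.diag, Fintype.sum_prod_type, sliceFst, Matrix.of_apply]
  exact Finset.sum_comm

theorem trFst_mem {x y : Type*} [Fintype x] {Y : Matrix (x × y) (x × y) ℂ}
    {S : Submodule ℂ (Matrix y y ℂ)} (h : ∀ a a', sliceSnd Y a a' ∈ S) : trFst Y ∈ S := by
  have : trFst Y = ∑ a, sliceSnd Y a a := by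
    ext; simp [trFst, sliceSnd, Matrix.sum_apply]
  exact this ▸ S.sum_mem fun a _ => h a a

theorem trace_trFst {x y : Type*} [Fintype x] [Fintype y]
    (Y : Matrix (x × y) (x × y) ℂ) : (trFst Y).trace = Y.trace := by
  simp only [Matrix.trace, Matrix.diag, Fintype.sum_prod_type, trFst, Matrix.of_apply]
  exact Finset.sum_comm

/-- The one-party trace formula is used twice: on each of Bob's diagonal blocks to eliminate Alice,
then on the combs left to Bob once Alice is traced out. -/
theorem trace_comp {Z : AdapterMatrix CI CO DI DO EI EO FI FO}
    {Y : AdapterMatrix AI AO BI BO CI CO DI DO}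
    (hZA : ∀ b b', sliceFst Z b b' ∈ combSpace CI EI EO CO)
    (hZB : ∀ a a', sliceSnd Z a a' ∈ combSpace DI FI FO DO)
    (hYA : ∀ b b', sliceFst Y b b' ∈ combSpace AI CI CO AO)
    (hYB : ∀ a a', sliceSnd Y a a' ∈ combSpace BI DI DO BO) :
    (Fintype.card CI * Fintype.card CO) * (Fintype.card DI * Fintype.card DO) *
      (comp Z Y).trace = Z.trace * Y.trace := by
  rw [← trace_trFst Z, ← trace_trFst Y, ← trace_localComp (trFst_mem hZB) (trFst_mem hYB),
    trace_eq_sum_sliceFst]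
  simp only [sliceFst_comp, Matrix.trace_sum]
  have h : ∀ b : Wires BI FI FO BO, (Fintype.card CI * Fintype.card CO : ℂ) * ∑ d : DI × DO,
      ∑ d' : DI × DO, (localComp
        (sliceFst Z (d.1, b.2.1, b.2.2.1, d.2) (d'.1, b.2.1, b.2.2.1, d'.2))
        (sliceFst Y (b.1, d.1, d.2, b.2.2.2) (b.1, d'.1, d'.2, b.2.2.2))).trace =
      localComp (trFst Z) (trFst Y) b b := by
    intro b
    simp only [Finset.mul_sum, trace_localComp (hZA _ _) (hYA _ _)]
    rfl
  rw [mul_comm (_ * _ : ℂ) (_ * _ : ℂ), mul_assoc, Finset.mul_sum,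
    Finset.sum_congr rfl fun b _ => h b]
  rfl

/-- The vector whose rank-one projector is the Choi matrix of the identity comb. -/
def identityVec (I O : Type*) [DecidableEq I] [DecidableEq O] : Wires I I O O → ℂ :=
  fun a => if a.1 = a.2.1 ∧ a.2.2.1 = a.2.2.2 then 1 else 0

/-- The Choi matrix of the identity adapter. -/
def identityAdapter (AI AO BI BO : Type*)
    [DecidableEq AI] [DecidableEq AO] [DecidableEq BI] [DecidableEq BO] :
    AdapterMatrix AI AO BI BO AI AO BI BO :=
  Matrix.of fun p q => identityVec AI AO p.1 * identityVec BI BO p.2 *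
    (identityVec AI AO q.1 * identityVec BI BO q.2)

theorem identity_mem_combSpace (z : ℂ) : (Matrix.of fun a a' => z *
    (identityVec AI AO a * identityVec AI AO a')) ∈ combSpace AI AI AO AO := by
  refine ⟨fun i i' j j' => z * if i = i' ∧ j = j' then 1 else 0, z, ?_, ?_⟩
  · intro i i' o' j j' p'
    simp only [Matrix.of_apply, identityVec, ← Finset.mul_sum]
    by_cases h : i = i' <;> by_cases h' : j = j' <;> simp [h, h']
  · intro i j
    simp [ite_and, eq_comm]

variable [Nonempty AI] [Nonempty AO] [Nonempty BI] [Nonempty BO]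
    [Nonempty CI] [Nonempty CO] [Nonempty DI] [Nonempty DO]
    [Nonempty EI] [Nonempty EO] [Nonempty FI] [Nonempty FO]

/-- The working form of freeness: the projector equation becomes linear conditions on blocks, which
pass easily to compositions and convex combinations. -/
theorem isFreeAdapter_iff (Y : AdapterMatrix AI AO BI BO CI CO DI DO) :
    IsFreeAdapter Y ↔ Y.PosSemidef ∧ (∀ b b', sliceFst Y b b' ∈ combSpace AI CI CO AO) ∧
      (∀ a a', sliceSnd Y a a' ∈ combSpace BI DI DO BO) ∧
      Y.trace = (Fintype.card AI : ℂ) * Fintype.card CO * Fintype.card BI * Fintype.card DO := by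
  refine and_congr_right fun _ => ?_
  rw [← and_assoc]
  refine and_congr_left fun _ => ⟨fun h => ⟨fun b b' => ?_, fun a a' => ?_⟩, fun ⟨hA, hB⟩ => ?_⟩
  · rw [h]
    exact sliceFst_localProj_mem _ _ _
  · rw [h]
    exact sliceSnd_localProj_mem _ _
      (fun a a' => sliceFst_localProj_mem (Y.reindex (Equiv.prodComm _ _) (Equiv.prodComm _ _)) a a')
      a a'
  · have h : projB Y = Y := by
      rw [projB, localProj_eq_self _ fun r s => hB r s]
      rfl
    rw [h]
    exact (localProj_eq_self Y hA).symm

theorem IsFreeAdapter.comp {Z : AdapterMatrix CI CO DI DO EI EO FI FO}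
    {Y : AdapterMatrix AI AO BI BO CI CO DI DO} (hZ : IsFreeAdapter Z) (hY : IsFreeAdapter Y) :
    IsFreeAdapter (comp Z Y) := by
  rw [isFreeAdapter_iff] at *
  obtain ⟨hZ, hZA, hZB, hZt⟩ := hZ
  obtain ⟨hY, hYA, hYB, hYt⟩ := hY
  refine ⟨(posSemidef_link (hZ.submatrix _) (hY.submatrix _)).submatrix _, fun b b' => ?_,
    fun a a' => ?_, ?_⟩
  · rw [sliceFst_comp]
    exact Submodule.sum_mem _ fun _ _ => Submodule.sum_mem _ fun _ _ =>
      localComp_mem (hZA _ _) (hYA _ _)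
  · rw [sliceSnd_comp]
    exact Submodule.sum_mem _ fun _ _ => Submodule.sum_mem _ fun _ _ =>
      localComp_mem (hZB _ _) (hYB _ _)
  · have h := trace_comp hZA hZB hYA hYB
    have h1 : (Fintype.card CI : ℂ) ≠ 0 := by simp
    have h2 : (Fintype.card CO : ℂ) ≠ 0 := by simp
    have h3 : (Fintype.card DI : ℂ) ≠ 0 := by simp
    have h4 : (Fintype.card DO : ℂ) ≠ 0 := by simp
    rw [hZt, hYt] at h
    refine mul_left_cancel₀ (mul_ne_zero (mul_ne_zero h1 h2) (mul_ne_zero h3 h4)) (h.trans ?_)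
    ring

theorem isFreeAdapter_identityAdapter : IsFreeAdapter (identityAdapter AI AO BI BO) := by
  rw [isFreeAdapter_iff]
  refine ⟨?_, fun b b' => ?_, fun a a' => ?_, ?_⟩
  · convert Matrix.posSemidef_vecMulVec_self_star fun p : Wires AI AI AO AO × Wires BI BI BO BO =>
      identityVec AI AO p.1 * identityVec BI BO p.2 using 1
    ext p q
    simp [identityAdapter, Matrix.vecMulVec_apply, identityVec, apply_ite (starRingEnd ℂ)]
  · convert identity_mem_combSpace (identityVec BI BO b * identityVec BI BO b') using 1
    ext a a'
    simp only [sliceFst, identityAdapter, Matrix.of_apply]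
    ring
  · convert identity_mem_combSpace (identityVec AI AO a * identityVec AI AO a') using 1
    ext b b'
    simp only [sliceSnd, identityAdapter, Matrix.of_apply]
    ring
  · simp [Matrix.trace, identityAdapter, Fintype.sum_prod_type, identityVec, ite_and, mul_assoc]

theorem adapt_identityAdapter
    (W : Matrix ((AI × AO) × (BI × BO)) ((AI × AO) × (BI × BO)) ℂ) :
    adapt (identityAdapter AI AO BI BO) W = W := by
  ext ⟨⟨ai, ao⟩, ⟨bi, bo⟩⟩ ⟨⟨ai', ao'⟩, ⟨bi', bo'⟩⟩
  simp [adapt_apply, identityAdapter, Fintype.sum_prod_type, identityVec, ite_and, regroup]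

end Adapters

/-! ### Hermitian perturbations of the identity -/

section Perturbation

open scoped Matrix.Norms.L2Operator MatrixOrder in
theorem exists_posSemidef_one_add_smul {n : Type*} [Fintype n] [DecidableEq n]
    {M : Matrix n n ℂ} (hM : M.IsHermitian) :
    ∃ ε : ℝ, 0 < ε ∧ (1 + (ε : ℂ) • M).PosSemidef := by
  have h : -algebraMap ℝ (Matrix n n ℂ) ‖M‖ ≤ M :=
    IsSelfAdjoint.neg_algebraMap_norm_le_self (a := M) hM
  rw [Matrix.le_iff] at h
  have hpos : (0 : ℝ) < ‖M‖ + 1 := by positivity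
  -- From `-‖M‖ ≤ M` in operator norm; the added 1 keeps the denominator positive when `M = 0`.
  refine ⟨(‖M‖ + 1)⁻¹, inv_pos.2 hpos, ?_⟩
  have hc : ((‖M‖ + 1 : ℝ) : ℂ) ≠ 0 := by exact_mod_cast hpos.ne'
  have e : 1 + (((‖M‖ + 1)⁻¹ : ℝ) : ℂ) • M =
      (((‖M‖ + 1)⁻¹ : ℝ) : ℂ) • (1 + (M - -algebraMap ℝ (Matrix n n ℂ) ‖M‖)) := by
    have : algebraMap ℝ (Matrix n n ℂ) ‖M‖ = (‖M‖ : ℂ) • (1 : Matrix n n ℂ) := by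
      rw [Algebra.algebraMap_eq_smul_one]
      ext i j
      simp [Matrix.smul_apply]
    rw [this, Complex.ofReal_inv, eq_inv_smul_iff₀ hc, smul_add, smul_smul, mul_inv_cancel₀ hc]
    push_cast
    module
  rw [e]
  exact (Matrix.PosSemidef.one.add h).smul (by exact_mod_cast (inv_pos.2 hpos).le)

end Perturbation

/-! ### Linear extension from channels to their span -/

section Channels

variable {I O : Type*} [Fintype I] [Fintype O] [DecidableEq I] [DecidableEq O]

theorem trSnd_add (M N : Matrix (I × O) (I × O) ℂ) : trSnd (M + N) = trSnd M + trSnd N := by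
  ext; simp [trSnd, Finset.sum_add_distrib]

theorem trSnd_smul (c : ℂ) (M : Matrix (I × O) (I × O) ℂ) : trSnd (c • M) = c • trSnd M := by
  ext; simp [trSnd, Finset.mul_sum]

theorem trSnd_conjTranspose (M : Matrix (I × O) (I × O) ℂ) : trSnd Mᴴ = (trSnd M)ᴴ := by
  ext; simp [trSnd, Matrix.conjTranspose_apply]

theorem trSnd_one : trSnd (1 : Matrix (I × O) (I × O) ℂ) = (Fintype.card O : ℂ) • 1 := by
  ext i j
  by_cases h : i = j <;> simp [trSnd, Matrix.one_apply, h]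

theorem trace_trSnd (M : Matrix (I × O) (I × O) ℂ) : (trSnd M).trace = M.trace := by
  simp [Matrix.trace, trSnd, Fintype.sum_prod_type]

/-- The linear span of the Choi matrices of channels from `I` to `O`. -/
def channelSpace (I O : Type*) [DecidableEq I] [Fintype O] :
    Submodule ℂ (Matrix (I × O) (I × O) ℂ) where
  carrier := {M | ∃ m : ℂ, trSnd M = m • 1}
  add_mem' := by
    rintro M N ⟨m, hm⟩ ⟨n, hn⟩
    refine ⟨m + n, ?_⟩
    rw [add_smul, ← hm, ← hn]
    ext; simp [trSnd, Finset.sum_add_distrib]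
  zero_mem' := ⟨0, by ext; simp [trSnd]⟩
  smul_mem' := by
    rintro a M ⟨m, hm⟩
    refine ⟨a * m, ?_⟩
    rw [mul_smul, ← hm]
    ext; simp [trSnd, Finset.mul_sum]

/-- A linear functional which is constant on channels is determined on their span. -/
theorem eq_of_forall_isChannel [Nonempty O] (φ : Matrix (I × O) (I × O) ℂ →ₗ[ℂ] ℂ) (κ : ℂ)
    (hφ : ∀ M, IsChannel M → φ M = κ) {M : Matrix (I × O) (I × O) ℂ} {m : ℂ}
    (hM : trSnd M = m • 1) : φ M = κ * m := by
  have hO : (Fintype.card O : ℂ) ≠ 0 := by simp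
  have hpos : (0 : ℂ) ≤ (Fintype.card O : ℂ)⁻¹ := by
    rw [← Complex.ofReal_natCast, ← Complex.ofReal_inv]
    exact_mod_cast inv_nonneg.2 (Nat.cast_nonneg (α := ℝ) _)
  have h1 : φ ((Fintype.card O : ℂ)⁻¹ • 1) = κ :=
    hφ _ ⟨Matrix.PosSemidef.one.smul hpos, by rw [trSnd_smul, trSnd_one, inv_smul_smul₀ hO]⟩
  -- The completely depolarising channel can be perturbed by a small multiple of `H` and stay a
  -- channel, so `φ` cannot see `H`.
  have hherm : ∀ H : Matrix (I × O) (I × O) ℂ, H.IsHermitian → trSnd H = 0 → φ H = 0 := by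
    intro H hH h0
    obtain ⟨ε, hε, hp⟩ := exists_posSemidef_one_add_smul hH
    have h2 : φ ((Fintype.card O : ℂ)⁻¹ • (1 + (ε : ℂ) • H)) = κ := by
      refine hφ _ ⟨hp.smul hpos, ?_⟩
      rw [trSnd_smul, trSnd_add, trSnd_one, trSnd_smul, h0, smul_zero, add_zero,
        inv_smul_smul₀ hO]
    rw [smul_add, map_add, h1, add_eq_left, map_smul, map_smul] at h2
    simpa [hO, hε.ne'] using h2
  have hzero : ∀ H : Matrix (I × O) (I × O) ℂ, trSnd H = 0 → φ H = 0 := by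
    intro H h0
    have hs : trSnd Hᴴ = 0 := by rw [trSnd_conjTranspose, h0, Matrix.conjTranspose_zero]
    have ha : φ (H + Hᴴ) = 0 := by
      refine hherm _ (Matrix.isHermitian_add_transpose_self H) ?_
      rw [trSnd_add, h0, hs, add_zero]
    have hb : φ (Complex.I • H + (Complex.I • H)ᴴ) = 0 := by
      refine hherm _ (Matrix.isHermitian_add_transpose_self _) ?_
      rw [trSnd_add, trSnd_conjTranspose, trSnd_smul, h0]
      simp
    rw [Matrix.conjTranspose_smul, map_add, map_smul, map_smul] at hb
    rw [map_add] at ha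
    have hb' : Complex.I * (φ H - φ Hᴴ) = 0 := by
      rw [mul_sub, sub_eq_add_neg]
      simpa using hb
    have := (mul_eq_zero.1 hb').resolve_left Complex.I_ne_zero
    linear_combination (ha + this) / 2
  have h3 := hzero (M - m • ((Fintype.card O : ℂ)⁻¹ • 1)) (by
    rw [sub_eq_add_neg, ← neg_smul, trSnd_add, trSnd_smul, trSnd_smul, trSnd_one, hM,
      inv_smul_smul₀ hO, ← add_smul, add_neg_cancel, zero_smul])
  rw [map_sub, map_smul, h1, sub_eq_zero] at h3
  rw [h3, smul_eq_mul, mul_comm]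

end Channels

/-- A bilinear pairing vanishing on `S × T` vanishes on every matrix with slices in `S` and `T`. -/
theorem trace_eq_zero_of_slices {x y : Type*} [Fintype x] [Fintype y] [DecidableEq y]
    {V N : Matrix (x × y) (x × y) ℂ}
    {S : Submodule ℂ (Matrix x x ℂ)} {T : Submodule ℂ (Matrix y y ℂ)}
    (hV : ∀ u ∈ S, ∀ v ∈ T, (V * (u ⊗ₖ v)).trace = 0)
    (hS : ∀ b b', sliceFst N b b' ∈ S) (hT : ∀ a a', sliceSnd N a a' ∈ T) :
    (V * N).trace = 0 := by
  -- `p` projects onto `T`. Applying it on the second factor of the expansion of `N` in matrix units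
  -- leaves `N` unchanged and exhibits it as a sum of elements of `S ⊗ T`.
  obtain ⟨p, hp⟩ := T.subtype.exists_leftInverse_of_injective T.ker_subtype
  have hp' : ∀ v ∈ T, (p v : Matrix y y ℂ) = v := fun v hv =>
    congrArg Subtype.val (LinearMap.congr_fun hp ⟨v, hv⟩)
  have hN : N = ∑ b, ∑ b', sliceFst N b b' ⊗ₖ (p (Matrix.single b b' 1) : Matrix y y ℂ) := by
    ext ⟨a, c⟩ ⟨a', c'⟩
    have h := congrFun (congrFun (hp' _ (hT a a')) c) c'
    rw [Matrix.matrix_eq_sum_single (sliceSnd N a a')] at h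
    have e : ∀ b b', Matrix.single b b' (sliceSnd N a a' b b') =
        N (a, b) (a', b') • Matrix.single b b' (1 : ℂ) := by
      intro b b'
      simp [sliceSnd, Matrix.smul_single]
    simp only [e, map_sum, map_smul, Submodule.coe_sum, Submodule.coe_smul, Matrix.sum_apply,
      Matrix.smul_apply, smul_eq_mul] at h
    simp only [Matrix.sum_apply, Matrix.kroneckerMap_apply, sliceFst, Matrix.of_apply]
    rw [h]
    simp [Matrix.single_apply, ite_and, eq_comm]
  rw [hN]
  simp only [Matrix.mul_sum, Matrix.trace_sum]
  exact Finset.sum_eq_zero fun b _ => Finset.sum_eq_zero fun b' _ => hV _ (hS b b') _ (p _).2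

/-! ### Free adapters preserve process matrices -/

section ProcessMatrices

variable {AI AO BI BO CI CO DI DO : Type*}
  [Fintype AI] [Fintype AO] [Fintype BI] [Fintype BO]
  [Fintype CI] [Fintype CO] [Fintype DI] [Fintype DO]
  [DecidableEq AI] [DecidableEq AO] [DecidableEq BI] [DecidableEq BO]
  [DecidableEq CI] [DecidableEq CO] [DecidableEq DI] [DecidableEq DO]
  [Nonempty AI] [Nonempty AO] [Nonempty BI] [Nonempty BO]
  [Nonempty CI] [Nonempty CO] [Nonempty DI] [Nonempty DO]

theorem IsProcess.trace_mul_kronecker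
    {W : Matrix ((AI × AO) × (BI × BO)) ((AI × AO) × (BI × BO)) ℂ} (hW : IsProcess W)
    {u : Matrix (AI × AO) (AI × AO) ℂ} {v : Matrix (BI × BO) (BI × BO) ℂ} {m n : ℂ}
    (hu : trSnd u = m • 1) (hv : trSnd v = n • 1) : (Wᵀ * (u ⊗ₖ v)).trace = m * n := by
  have h1 : ∀ M, IsChannel M → (Wᵀ * (M ⊗ₖ v)).trace = n := by
    intro M hM
    let φ : Matrix (BI × BO) (BI × BO) ℂ →ₗ[ℂ] ℂ :=
      { toFun := fun v => (Wᵀ * (M ⊗ₖ v)).trace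
        map_add' := by simp [Matrix.kronecker_add, mul_add]
        map_smul' := by simp [Matrix.kronecker_smul] }
    simpa [φ] using eq_of_forall_isChannel φ 1 (fun v hv => hW.2 M v hM hv) hv
  let φ : Matrix (AI × AO) (AI × AO) ℂ →ₗ[ℂ] ℂ :=
    { toFun := fun u => (Wᵀ * (u ⊗ₖ v)).trace
      map_add' := by simp [Matrix.add_kronecker, mul_add]
      map_smul' := by simp [Matrix.smul_kronecker] }
  rw [mul_comm]
  exact eq_of_forall_isChannel φ n h1 hu

/-- An adapter with trivial outputs, as an operator on the wires of the process it closes. -/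
def closing (X : AdapterMatrix AI AO BI BO Unit Unit Unit Unit) :
    Matrix ((AI × AO) × (BI × BO)) ((AI × AO) × (BI × BO)) ℂ :=
  X.submatrix (fun k => regroup.symm ((((), ()), ((), ())), k))
    (fun k => regroup.symm ((((), ()), ((), ())), k))

theorem adapt_closing (X : AdapterMatrix AI AO BI BO Unit Unit Unit Unit)
    (W : Matrix ((AI × AO) × (BI × BO)) ((AI × AO) × (BI × BO)) ℂ) :
    adapt X W default default = (Wᵀ * closing X).trace := by
  rw [adapt_apply, Finset.sum_comm]
  simp only [Matrix.trace, Matrix.diag, Matrix.mul_apply, Matrix.transpose_apply, mul_comm]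
  rfl

theorem mem_channelSpace_of_mem_combSpace {I O : Type*} [Fintype I] [Fintype O] [DecidableEq I]
    {M : Matrix (Wires I Unit Unit O) (Wires I Unit Unit O) ℂ}
    (h : M ∈ combSpace I Unit Unit O) :
    M.submatrix (fun k : I × O => (k.1, (), (), k.2)) (fun k => (k.1, (), (), k.2)) ∈
      channelSpace I O := by
  obtain ⟨N, c, h1, h2⟩ := h
  refine ⟨c, ?_⟩
  ext i j
  have := h1 i () () j () ()
  have h2 := h2 i j
  simp only [Finset.univ_unique, Finset.sum_singleton, if_true] at this h2
  simp only [trSnd, Matrix.submatrix_apply, Matrix.of_apply, Matrix.smul_apply, Matrix.one_apply,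
    smul_eq_mul, mul_ite, mul_one, mul_zero]
  exact this.trans h2

/-- On the span of pairs of channels, `Wᵀ` acts as a multiple of the trace; the blocks of a closed
free adapter place it in that span, and its trace is known. -/
theorem IsProcess.adapt_closing_eq_one
    {W : Matrix ((AI × AO) × (BI × BO)) ((AI × AO) × (BI × BO)) ℂ} (hW : IsProcess W)
    {X : AdapterMatrix AI AO BI BO Unit Unit Unit Unit} (hX : IsFreeAdapter X) :
    (Wᵀ * closing X).trace = 1 := by
  rw [isFreeAdapter_iff] at hX
  obtain ⟨-, hA, hB, ht⟩ := hX
  have hAI : (Fintype.card AI : ℂ) ≠ 0 := by simp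
  have hBI : (Fintype.card BI : ℂ) ≠ 0 := by simp
  have htr : (closing X).trace = Fintype.card AI * Fintype.card BI := by
    have e : (closing X).trace = X.trace := by
      simp [closing, Matrix.trace, Fintype.sum_prod_type, regroup]
    rw [e, ht]
    simp
  have h := trace_eq_zero_of_slices (S := channelSpace AI AO) (T := channelSpace BI BO)
    (V := Wᵀ - ((Fintype.card AI : ℂ) * Fintype.card BI)⁻¹ • 1) (N := closing X)
    (fun u ⟨m, hu⟩ v ⟨n, hv⟩ => by
      have h1 : u.trace = Fintype.card AI * m := by
        rw [← trace_trSnd, hu]; simp [mul_comm]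
      have h2 : v.trace = Fintype.card BI * n := by
        rw [← trace_trSnd, hv]; simp [mul_comm]
      rw [sub_mul, Matrix.trace_sub, hW.trace_mul_kronecker hu hv, smul_mul_assoc, one_mul,
        Matrix.trace_smul, Matrix.trace_kronecker, h1, h2, smul_eq_mul]
      field_simp
      ring)
    (fun b b' => mem_channelSpace_of_mem_combSpace (hA (b.1, (), (), b.2) (b'.1, (), (), b'.2)))
    (fun a a' => mem_channelSpace_of_mem_combSpace (hB (a.1, (), (), a.2) (a'.1, (), (), a'.2)))
  rw [sub_mul, Matrix.trace_sub, smul_mul_assoc, one_mul, Matrix.trace_smul, htr, smul_eq_mul,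
    inv_mul_cancel₀ (mul_ne_zero hAI hBI), sub_eq_zero] at h
  exact h

/-- A pair of channels, as an adapter with trivial outputs. -/
def channelAdapter (MA : Matrix (AI × AO) (AI × AO) ℂ) (MB : Matrix (BI × BO) (BI × BO) ℂ) :
    AdapterMatrix AI AO BI BO Unit Unit Unit Unit :=
  (MA ⊗ₖ MB).submatrix (fun p => (regroup p).2) (fun p => (regroup p).2)

theorem mem_combSpace_of_isChannel {I O : Type*} [Fintype I] [Fintype O] [DecidableEq I]
    {M : Matrix (I × O) (I × O) ℂ} (h : trSnd M = 1) (z : ℂ) :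
    (Matrix.of fun p q => z * M (p.1, p.2.2.2) (q.1, q.2.2.2)) ∈ combSpace I Unit Unit O := by
  refine ⟨fun i _ j _ => if i = j then z else 0, z, fun i _ _ j _ _ => ?_, fun i j => by simp⟩
  have := congrFun (congrFun h i) j
  simp only [trSnd, Matrix.of_apply, Matrix.one_apply] at this
  simp [← Finset.mul_sum, this]

theorem isFreeAdapter_channelAdapter {MA : Matrix (AI × AO) (AI × AO) ℂ}
    {MB : Matrix (BI × BO) (BI × BO) ℂ} (hA : IsChannel MA) (hB : IsChannel MB) :
    IsFreeAdapter (channelAdapter MA MB) := by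
  rw [isFreeAdapter_iff]
  refine ⟨(hA.1.kronecker hB.1).submatrix _, fun b b' => ?_, fun a a' => ?_, ?_⟩
  · convert mem_combSpace_of_isChannel hA.2 (MB (b.1, b.2.2.2) (b'.1, b'.2.2.2)) using 1
    ext a a'
    exact mul_comm _ _
  · exact mem_combSpace_of_isChannel hB.2 (MA (a.1, a.2.2.2) (a'.1, a'.2.2.2))
  · have h : (channelAdapter MA MB).trace = (MA ⊗ₖ MB).trace := by
      simp [channelAdapter, Matrix.trace, Fintype.sum_prod_type, regroup]
    rw [h, Matrix.trace_kronecker, ← trace_trSnd MA, ← trace_trSnd MB, hA.2, hB.2]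
    simp

theorem IsProcess.adapt {W : Matrix ((AI × AO) × (BI × BO)) ((AI × AO) × (BI × BO)) ℂ}
    (hW : IsProcess W) {Y : AdapterMatrix AI AO BI BO CI CO DI DO} (hY : IsFreeAdapter Y) :
    IsProcess (adapt Y W) := by
  -- A pair of channels is itself a free adapter to trivial spaces; composed with `Y` it closes `W`.
  refine ⟨posSemidef_adapt hY.1 hW.1, fun MA MB hA hB => ?_⟩
  have hZ := isFreeAdapter_channelAdapter hA hB
  have e : MA ⊗ₖ MB = closing (channelAdapter MA MB) := rfl
  rw [e, ← adapt_closing, ← adapt_comp, adapt_closing, hW.adapt_closing_eq_one (hZ.comp hY)]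

end ProcessMatrices

/-! ### Closedness and bounds for positive semidefinite matrices -/

section Topology

variable {n : Type*} [Fintype n]

theorem isClosed_setOf_posSemidef : IsClosed {M : Matrix n n ℂ | M.PosSemidef} := by
  simp only [Matrix.posSemidef_iff_dotProduct_mulVec, Set.ofPred_and, Set.ofPred_forall]
  refine IsClosed.inter (isClosed_eq (by fun_prop) continuous_id)
    (isClosed_iInter fun x => isClosed_le continuous_const (by fun_prop))

theorem norm_apply_le_trace {M : Matrix n n ℂ} (hM : M.PosSemidef) (i j : n) :
    ‖M i j‖ ≤ M.trace.re := by
  classical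
  have hd : ∀ k, 0 ≤ M k k := fun k => hM.diag_nonneg
  have hle : ∀ k, (M k k).re ≤ M.trace.re := by
    intro k
    rw [Matrix.trace, Complex.re_sum]
    exact Finset.single_le_sum (f := fun k => (M.diag k).re)
      (fun l _ => (Complex.le_def.1 (hd l)).1) (Finset.mem_univ k)
  -- The 2×2 principal minor yields `|M i j|² ≤ M i i * M j j`.
  have hdet := (hM.submatrix ![i, j]).det_nonneg
  rw [Matrix.det_fin_two] at hdet
  have hji : M j i = star (M i j) := (hM.1.apply j i).symm
  simp only [Matrix.submatrix_apply, Matrix.cons_val_zero, Matrix.cons_val_one, hji] at hdet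
  have h1 := (Complex.le_def.1 hdet).1
  have hi := Complex.le_def.1 (hd i)
  have hj := Complex.le_def.1 (hd j)
  have h2 : ‖M i j‖ ^ 2 ≤ (M i i).re * (M j j).re := by
    rw [Complex.sq_norm, Complex.normSq_apply]
    simp only [Complex.zero_re, Complex.sub_re, Complex.mul_re, Complex.star_def,
      Complex.conj_re, Complex.conj_im, ← hi.2, ← hj.2] at h1
    simp at h1
    linarith
  refine abs_le_of_sq_le_sq' (h2.trans ?_) ((Complex.le_def.1 (hd i)).1.trans (hle i)) |>.2
  rw [sq]
  exact mul_le_mul (hle i) (hle j) hj.1 (hi.1.trans (hle i))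

theorem continuous_replaceTr {x y : Type*} [Fintype x] [DecidableEq x] (e : n ≃ x × y) :
    Continuous (replaceTr e) := by
  refine continuous_matrix fun i j => ?_
  simp only [replaceTr_apply]
  split_ifs <;> fun_prop

end Topology

/-! ### Separation by the nearest point -/

section Separation

variable {n : Type*} [Fintype n]

theorem re_trace_sub_smul_mul_self (P D : Matrix n n ℂ) (s : ℝ) :
    ((P - s • D) * (P - s • D)).trace.re =
      (P * P).trace.re - 2 * s * (P * D).trace.re + s ^ 2 * (D * D).trace.re := by
  simp only [sub_mul, mul_sub, Matrix.smul_mul, Matrix.mul_smul, Matrix.trace_sub,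
    Matrix.trace_smul, Complex.sub_re, Complex.real_smul, Complex.re_ofReal_mul,
    Matrix.trace_mul_comm D P]
  ring

/-- A compact convex set of Hermitian matrices is separated from a Hermitian matrix outside it by
the difference with the nearest point. -/
theorem exists_separating {K : Set (Matrix n n ℂ)} (hK : IsCompact K) (hconv : Convex ℝ K)
    (hne : K.Nonempty) (hherm : ∀ X ∈ K, X.IsHermitian) {V : Matrix n n ℂ} (hV : V.IsHermitian)
    (hVK : V ∉ K) : ∃ X₀ ∈ K, (∀ X ∈ K, ((V - X₀) * X).trace.re ≤ ((V - X₀) * X₀).trace.re) ∧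
      ((V - X₀) * X₀).trace.re < ((V - X₀) * V).trace.re := by
  obtain ⟨X₀, hX₀, hmin⟩ := hK.exists_isMinOn hne
    (f := fun X => ((V - X) * (V - X)).trace.re)
    (Complex.continuous_re.comp (by fun_prop : Continuous fun X : Matrix n n ℂ =>
      ((V - X) * (V - X)).trace)).continuousOn
  have hP : (V - X₀).IsHermitian := hV.sub (hherm _ hX₀)
  refine ⟨X₀, hX₀, fun X hX => ?_, ?_⟩
  · set P := V - X₀ with hPdef
    set a := (P * (X - X₀)).trace.re with ha
    set b := ((X - X₀) * (X - X₀)).trace.re with hb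
    -- Moving from `X₀` towards `X` by `s` does not decrease the distance to `V`.
    have key : ∀ s : ℝ, 0 < s → s ≤ 1 → 2 * a ≤ s * b := by
      intro s hs hs1
      have hmem : X₀ + s • (X - X₀) ∈ K := hconv.add_smul_sub_mem hX₀ hX ⟨hs.le, hs1⟩
      have h := isMinOn_iff.1 hmin _ hmem
      have e : V - (X₀ + s • (X - X₀)) = P - s • (X - X₀) := by rw [hPdef]; abel
      rw [e, re_trace_sub_smul_mul_self, ← ha, ← hb] at h
      nlinarith
    have ha0 : a ≤ 0 := by
      by_contra! hpos
      have hb1 : 0 < |b| + a + 1 := by positivity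
      -- This `s` is at most 1 and satisfies `s * b < a`, against `2 * a ≤ s * b`.
      have h := key (a / (|b| + a + 1)) (by positivity)
        ((div_le_one hb1).2 (by linarith [abs_nonneg b]))
      rw [div_mul_eq_mul_div, le_div_iff₀ hb1] at h
      nlinarith [le_abs_self b, mul_le_mul_of_nonneg_left (le_abs_self b) hpos.le,
        mul_nonneg hpos.le (abs_nonneg b)]
    rw [ha, mul_sub, Matrix.trace_sub, Complex.sub_re] at ha0
    linarith
  · have hne0 : V - X₀ ≠ 0 := fun h => hVK (sub_eq_zero.1 h ▸ hX₀)
    have h0 : 0 ≤ ((V - X₀)ᴴ * (V - X₀)).trace :=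
      (Matrix.posSemidef_conjTranspose_mul_self _).trace_nonneg
    have h1 : ((V - X₀)ᴴ * (V - X₀)).trace ≠ 0 := fun h =>
      hne0 (Matrix.trace_conjTranspose_mul_self_eq_zero_iff.1 h)
    rw [hP.eq] at h0 h1
    have h2 := (Complex.lt_def.1 (lt_of_le_of_ne h0 h1.symm)).1
    rw [mul_sub, Matrix.trace_sub, Complex.sub_re, Complex.zero_re, sub_pos] at h2
    exact h2

end Separation

/-! ### Compactness, monotonicity and completeness -/

section Monotones

variable {AI AO BI BO CI CO DI DO EI EO FI FO : Type*}
  [Fintype AI] [Fintype AO] [Fintype BI] [Fintype BO]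
  [Fintype CI] [Fintype CO] [Fintype DI] [Fintype DO]
  [Fintype EI] [Fintype EO] [Fintype FI] [Fintype FO]
  [DecidableEq AI] [DecidableEq AO] [DecidableEq BI] [DecidableEq BO]
  [DecidableEq CI] [DecidableEq CO] [DecidableEq DI] [DecidableEq DO]
  [DecidableEq EI] [DecidableEq EO] [DecidableEq FI] [DecidableEq FO]

theorem continuous_localProj {I I' O' O R : Type*} [Fintype I] [Fintype I'] [Fintype O']
    [Fintype O] [Fintype R] [DecidableEq I] [DecidableEq I'] [DecidableEq O'] [DecidableEq O] :
    Continuous (localProj (I := I) (I' := I') (O' := O') (O := O) (R := R)) := by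
  have h1 := continuous_replaceTr (splitO (I := I) (I' := I') (O' := O') (O := O) (R := R))
  have h2 := continuous_replaceTr (splitOO (I := I) (I' := I') (O' := O') (O := O) (R := R))
  have h3 := continuous_replaceTr (splitIOO (I := I) (I' := I') (O' := O') (O := O) (R := R))
  have h4 := continuous_replaceTr (Equiv.refl (Wires I I' O' O × R))
  unfold localProj
  exact (((continuous_id.sub h1).add h2).sub h3).add h4

/-- The defining conditions are closed, and the fixed trace bounds every entry of a positive
semidefinite matrix. -/
theorem isCompact_setOf_isFreeAdapter :
    IsCompact {Y : AdapterMatrix AI AO BI BO CI CO DI DO | IsFreeAdapter Y} := by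
  set R : ℝ := ((Fintype.card AI : ℂ) * Fintype.card CO * Fintype.card BI * Fintype.card DO).re
  have hbox : IsCompact (Set.univ.pi fun _ => Set.univ.pi fun _ => Metric.closedBall (0 : ℂ) R :
      Set (AdapterMatrix AI AO BI BO CI CO DI DO)) :=
    isCompact_univ_pi fun _ => isCompact_univ_pi fun _ => isCompact_closedBall _ _
  refine hbox.of_isClosed_subset ?_ fun Y hY i _ j _ => ?_
  · have hA : Continuous (projA : AdapterMatrix AI AO BI BO CI CO DI DO → _) :=
      continuous_localProj
    have hB : Continuous (projB : AdapterMatrix AI AO BI BO CI CO DI DO → _) :=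
      (continuous_localProj.comp (continuous_id.matrix_reindex _ _)).matrix_reindex _ _
    exact isClosed_setOf_posSemidef.inter ((isClosed_eq continuous_id (hA.comp hB)).inter
      (isClosed_eq (by fun_prop) continuous_const))
  · rw [mem_closedBall_zero_iff]
    refine (norm_apply_le_trace hY.1 i j).trans_eq ?_
    rw [hY.2.2]

theorem continuous_adapt (W : Matrix ((AI × AO) × (BI × BO)) ((AI × AO) × (BI × BO)) ℂ) :
    Continuous fun Y : AdapterMatrix AI AO BI BO CI CO DI DO => adapt Y W := by
  refine continuous_matrix fun i j => ?_
  simp only [adapt_apply]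
  fun_prop

variable [Nonempty AI] [Nonempty AO] [Nonempty BI] [Nonempty BO]
  [Nonempty CI] [Nonempty CO] [Nonempty DI] [Nonempty DO]
  [Nonempty EI] [Nonempty EO] [Nonempty FI] [Nonempty FO]

theorem smul_one_mem_combSpace (z : ℂ) : z • (1 : Matrix (Wires AI CI CO AO) _ ℂ) ∈
    combSpace AI CI CO AO := by
  refine Submodule.smul_mem _ _ ⟨fun i i' j j' => if i = j ∧ i' = j' then Fintype.card AO else 0,
    Fintype.card CI * Fintype.card AO, fun i i' o' j j' p' => ?_, fun i j => ?_⟩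
  · by_cases h1 : i = j <;> by_cases h2 : i' = j' <;> by_cases h3 : o' = p' <;>
      simp [Matrix.one_apply, h1, h2, h3]
  · by_cases h : i = j <;> simp [h]

theorem exists_isFreeAdapter : ∃ Y : AdapterMatrix AI AO BI BO CI CO DI DO, IsFreeAdapter Y := by
  -- The normalisation giving the multiple of the identity the trace required of an adapter.
  set z : ℝ := ((Fintype.card CI : ℝ) * Fintype.card AO * Fintype.card DI * Fintype.card BO)⁻¹
    with hz
  have hz0 : 0 ≤ z := by positivity
  refine ⟨(z : ℂ) • 1, (isFreeAdapter_iff _).2 ⟨Matrix.PosSemidef.one.smul (by exact_mod_cast hz0),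
    fun b b' => ?_, fun a a' => ?_, ?_⟩⟩
  · convert smul_one_mem_combSpace (AI := AI) (CI := CI) (CO := CO) (AO := AO)
      ((z : ℂ) * if b = b' then 1 else 0) using 1
    ext a a'
    by_cases h1 : a = a' <;> by_cases h2 : b = b' <;>
      simp [sliceFst, Matrix.one_apply, h1, h2]
  · convert smul_one_mem_combSpace (AI := BI) (CI := DI) (CO := DO) (AO := BO)
      ((z : ℂ) * if a = a' then 1 else 0) using 1
    ext b b'
    by_cases h1 : a = a' <;> by_cases h2 : b = b' <;>
      simp [sliceSnd, Matrix.one_apply, h1, h2]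
  · have h1 : (Fintype.card CI : ℂ) ≠ 0 := by simp
    have h2 : (Fintype.card AO : ℂ) ≠ 0 := by simp
    have h3 : (Fintype.card DI : ℂ) ≠ 0 := by simp
    have h4 : (Fintype.card BO : ℂ) ≠ 0 := by simp
    rw [Matrix.trace_smul, Matrix.trace_one, hz]
    simp only [Fintype.card_prod]
    push_cast
    simp only [smul_eq_mul]
    field_simp

theorem convex_setOf_isFreeAdapter :
    Convex ℝ {Y : AdapterMatrix AI AO BI BO CI CO DI DO | IsFreeAdapter Y} := by
  intro Y hY Z hZ s t hs ht hst
  rw [Set.mem_ofPred_eq, isFreeAdapter_iff] at *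
  obtain ⟨hY, hYA, hYB, hYt⟩ := hY
  obtain ⟨hZ, hZA, hZB, hZt⟩ := hZ
  have e : s • Y + t • Z = (s : ℂ) • Y + (t : ℂ) • Z := by ext; simp
  have hst' : (s : ℂ) + t = 1 := by exact_mod_cast hst
  rw [e]
  refine ⟨(hY.smul (by exact_mod_cast hs)).add (hZ.smul (by exact_mod_cast ht)),
    fun b b' => Submodule.add_mem _ (Submodule.smul_mem _ _ (hYA b b'))
      (Submodule.smul_mem _ _ (hZA b b')),
    fun a a' => Submodule.add_mem _ (Submodule.smul_mem _ _ (hYB a a'))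
      (Submodule.smul_mem _ _ (hZB a a')), ?_⟩
  rw [Matrix.trace_add, Matrix.trace_smul, Matrix.trace_smul, hYt, hZt, ← add_smul, hst', one_smul]

theorem isGreatest_monotone
    (Q : Matrix ((CI × CO) × (DI × DO)) ((CI × CO) × (DI × DO)) ℂ)
    (W : Matrix ((AI × AO) × (BI × BO)) ((AI × AO) × (BI × BO)) ℂ) :
    IsGreatest (freeValues Q W) (monotone Q W) := by
  have hc : Continuous fun Y : AdapterMatrix AI AO BI BO CI CO DI DO =>
      (Q * adapt Y W).trace.re :=
    Complex.continuous_re.comp (continuous_const.matrix_mul (continuous_adapt W)).matrix_trace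
  have h : freeValues Q W = (fun Y : AdapterMatrix AI AO BI BO CI CO DI DO =>
      (Q * adapt Y W).trace.re) '' {Y | IsFreeAdapter Y} := by
    ext r
    simp [freeValues, eq_comm]
  have hne : (freeValues Q W).Nonempty := by
    rw [h]
    exact Set.Nonempty.image _ exists_isFreeAdapter
  exact (h ▸ isCompact_setOf_isFreeAdapter.image hc).isGreatest_sSup hne

/-- An optimal `Z` for `adapt Y W` gives the competitor `comp Z Y` for `W`. -/
theorem monotone_adapt_le
    (Q : Matrix ((EI × EO) × (FI × FO)) ((EI × EO) × (FI × FO)) ℂ)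
    (W : Matrix ((AI × AO) × (BI × BO)) ((AI × AO) × (BI × BO)) ℂ)
    {Y : AdapterMatrix AI AO BI BO CI CO DI DO} (hY : IsFreeAdapter Y) :
    monotone Q (adapt Y W) ≤ monotone Q W := by
  obtain ⟨Z, hZ, hr⟩ := (isGreatest_monotone Q (adapt Y W)).1
  exact (isGreatest_monotone Q W).2 ⟨comp Z Y, hZ.comp hY, by rw [hr, adapt_comp]⟩

theorem IsProcess.trace_eq {W : Matrix ((AI × AO) × (BI × BO)) ((AI × AO) × (BI × BO)) ℂ}
    (hW : IsProcess W) : W.trace = (Fintype.card AO : ℂ) * Fintype.card BO := by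
  have h := hW.trace_mul_kronecker (trSnd_one (I := AI) (O := AO)) (trSnd_one (I := BI) (O := BO))
  rwa [Matrix.one_kronecker_one, mul_one, Matrix.trace_transpose] at h

/-- Perturbing the maximally mixed process in a direction joining two processes gives, after
rescaling the direction, a process. -/
theorem IsProcess.exists_perturbation
    {V X : Matrix ((AI × AO) × (BI × BO)) ((AI × AO) × (BI × BO)) ℂ}
    (hV : IsProcess V) (hX : IsProcess X) : ∃ c ε : ℝ, 0 < c ∧ 0 < ε ∧
      IsProcess ((c : ℂ) • (1 + (ε : ℂ) • (V - X))) := by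
  obtain ⟨ε, hε, hp⟩ := exists_posSemidef_one_add_smul (hV.1.1.sub hX.1.1)
  -- A product of channels has trace `d_AI * d_BI`, so this factor normalises the identity; the
  -- direction `V - X` pairs to zero with it.
  have hc : 0 < ((Fintype.card AI : ℝ) * Fintype.card BI)⁻¹ := by
    have := Fintype.card_pos (α := AI)
    have := Fintype.card_pos (α := BI)
    positivity
  refine ⟨_, ε, hc, hε, hp.smul (by exact_mod_cast hc.le), fun MA MB hA hB => ?_⟩
  have h1 : (Fintype.card AI : ℂ) ≠ 0 := by simp
  have h2 : (Fintype.card BI : ℂ) ≠ 0 := by simp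
  simp only [Matrix.transpose_smul, Matrix.transpose_add, Matrix.transpose_sub,
    Matrix.transpose_one, Matrix.smul_mul, add_mul, sub_mul, one_mul, Matrix.trace_smul,
    Matrix.trace_add, Matrix.trace_sub, hV.2 MA MB hA hB, hX.2 MA MB hA hB, sub_self, smul_zero,
    add_zero, Matrix.trace_kronecker]
  rw [← trace_trSnd MA, ← trace_trSnd MB, hA.2, hB.2]
  simp only [Matrix.trace_one, smul_eq_mul]
  push_cast
  exact inv_mul_cancel₀ (mul_ne_zero h1 h2)

theorem exists_isFreeAdapter_of_monotone_le
    {W : Matrix ((AI × AO) × (BI × BO)) ((AI × AO) × (BI × BO)) ℂ} (hW : IsProcess W)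
    {V : Matrix ((CI × CO) × (DI × DO)) ((CI × CO) × (DI × DO)) ℂ} (hV : IsProcess V)
    (h : ∀ Q : Matrix ((CI × CO) × (DI × DO)) ((CI × CO) × (DI × DO)) ℂ, IsProcess Q →
      monotone Q V ≤ monotone Q W) :
    ∃ Y : AdapterMatrix AI AO BI BO CI CO DI DO, IsFreeAdapter Y ∧ V = adapt Y W := by
  by_contra hcon
  let T : AdapterMatrix AI AO BI BO CI CO DI DO →ₗ[ℝ]
      Matrix ((CI × CO) × (DI × DO)) ((CI × CO) × (DI × DO)) ℂ :=
    { toFun := fun Y => adapt Y W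
      map_add' := fun Y Z => by
        ext p q; simp [adapt_apply, add_mul, Finset.sum_add_distrib]
      map_smul' := fun s Y => by
        ext p q; simp [adapt_apply, mul_assoc, Finset.mul_sum] }
  obtain ⟨_, ⟨Y₀, hY₀, rfl⟩, hmax, hlt⟩ := exists_separating (V := V)
    (K := (fun Y : AdapterMatrix AI AO BI BO CI CO DI DO => adapt Y W) '' {Y | IsFreeAdapter Y})
    (isCompact_setOf_isFreeAdapter.image (continuous_adapt W))
    (convex_setOf_isFreeAdapter.linear_image T) ((Set.Nonempty.image _ exists_isFreeAdapter))
    (by rintro _ ⟨Y, hY, rfl⟩; exact (hW.adapt hY).1.1) hV.1.1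
    (by rintro ⟨Y, hY, e⟩; exact hcon ⟨Y, hY, e.symm⟩)
  set X₀ := adapt Y₀ W
  obtain ⟨c, ε, hc, hε, hQ⟩ := hV.exists_perturbation (hW.adapt hY₀)
  set Q := (c : ℂ) • (1 + (ε : ℂ) • (V - X₀)) with hQdef
  -- As all processes have the same trace, `Q` evaluates them as an increasing affine function of
  -- the separating functional.
  have hval : ∀ X, IsProcess X → (Q * X).trace.re =
      c * ((Fintype.card CO : ℝ) * Fintype.card DO + ε * ((V - X₀) * X).trace.re) := by
    intro X hX
    rw [hQdef]
    simp only [Matrix.smul_mul, add_mul, one_mul, Matrix.trace_smul, Matrix.trace_add,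
      hX.trace_eq, smul_eq_mul, Complex.re_ofReal_mul, Complex.add_re]
    simp
  obtain ⟨Y, hY, hr⟩ := (isGreatest_monotone Q W).1
  have h1 : (Q * V).trace.re ≤ monotone Q V := (isGreatest_monotone Q V).2
    ⟨_, isFreeAdapter_identityAdapter, by rw [adapt_identityAdapter]⟩
  have h2 := h1.trans (h Q hQ)
  rw [hr, hval _ hV, hval _ (hW.adapt hY)] at h2
  have h3 := hmax _ ⟨Y, hY, rfl⟩
  have h4 := lt_of_le_of_lt h3 hlt
  have h5 := le_of_mul_le_mul_left h2 hc
  have h6 := mul_lt_mul_of_pos_left h4 hε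
  linarith

end Monotones

end CausalConnection

theorem mainTheorem9 {AI AO BI BO AI' AO' BI' BO' : Type*}
    [Fintype AI] [Fintype AO] [Fintype BI] [Fintype BO]
    [Fintype AI'] [Fintype AO'] [Fintype BI'] [Fintype BO']
    [DecidableEq AI] [DecidableEq AO] [DecidableEq BI] [DecidableEq BO]
    [DecidableEq AI'] [DecidableEq AO'] [DecidableEq BI'] [DecidableEq BO']
    [Nonempty AI] [Nonempty AO] [Nonempty BI] [Nonempty BO]
    [Nonempty AI'] [Nonempty AO'] [Nonempty BI'] [Nonempty BO']
    (W : Matrix ((AI × AO) × (BI × BO)) ((AI × AO) × (BI × BO)) ℂ)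
    (hW : CausalConnection.IsProcess W) :
    -- the maximum defining `f_Q(W)` is attained
    (∀ Q : Matrix ((AI' × AO') × (BI' × BO')) ((AI' × AO') × (BI' × BO')) ℂ,
      CausalConnection.IsProcess Q →
        IsGreatest (CausalConnection.freeValues Q W) (CausalConnection.monotone Q W)) ∧
    -- each `f_Q` is non-increasing under free adapters into processes on arbitrary spaces
    (∀ (CI CO DI DO : Type) [Fintype CI] [Fintype CO] [Fintype DI] [Fintype DO]
      [DecidableEq CI] [DecidableEq CO] [DecidableEq DI] [DecidableEq DO]
      [Nonempty CI] [Nonempty CO] [Nonempty DI] [Nonempty DO]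
      (Q : Matrix ((AI' × AO') × (BI' × BO')) ((AI' × AO') × (BI' × BO')) ℂ)
      (Y : CausalConnection.AdapterMatrix AI AO BI BO CI CO DI DO),
      CausalConnection.IsProcess Q → CausalConnection.IsFreeAdapter Y →
        CausalConnection.monotone Q (CausalConnection.adapt Y W) ≤
          CausalConnection.monotone Q W) ∧
    -- convertibility of `W` into `W'` is equivalent to the inequality for all `f_Q`
    (∀ W' : Matrix ((AI' × AO') × (BI' × BO')) ((AI' × AO') × (BI' × BO')) ℂ,
      CausalConnection.IsProcess W' →
        ((∃ Y : CausalConnection.AdapterMatrix AI AO BI BO AI' AO' BI' BO',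
            CausalConnection.IsFreeAdapter Y ∧ W' = CausalConnection.adapt Y W) ↔
          ∀ Q : Matrix ((AI' × AO') × (BI' × BO')) ((AI' × AO') × (BI' × BO')) ℂ,
            CausalConnection.IsProcess Q →
              CausalConnection.monotone Q W' ≤ CausalConnection.monotone Q W)) := by
  refine ⟨fun Q _ => CausalConnection.isGreatest_monotone Q W,
    fun CI CO DI DO _ _ _ _ _ _ _ _ _ _ _ _ Q Y _ hY =>
      CausalConnection.monotone_adapt_le Q W hY,
    fun W' hW' => ⟨?_, CausalConnection.exists_isFreeAdapter_of_monotone_le hW hW'⟩⟩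
  rintro ⟨Y, hY, rfl⟩ Q _
  exact CausalConnection.monotone_adapt_le Q W hY
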